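/- Let $m \ge 2$ be an integer and $r > 0$, and put $r_m := \sqrt{2(m+1)/m}$ and $N := m(m+3)/2$. For $s > 0$ let $\mathbb{S}^m(s) \subset \mathbb{R}^{m+1}$ be the sphere of radius $s$ about the origin, and let $\mathbb{RP}^m(s) := \{[x] : x \in \mathbb{S}^m(s)\}$ be its quotient by the relation $x \sim y :\Leftrightarrow x = y$ or $x = -y$, with the smooth structure and the Riemannian metric inherited from the round sphere $\mathbb{S}^m(s)$ (so that $x \mapsto [x]$ is a local isometry). For $[x] \in \mathbb{RP}^m(r_m)$ let $\frac{r}{r_m}[x] := [\frac{r}{r_m}x] \in \mathbb{RP}^m(r)$. Define $F_k : \mathbb{R}^{k+1} \times \mathbb{R}^{k+1} \to \mathbb{R}^{k(k+3)/2}$ for $k \ge 1$ recursively by $$F_1\big((x_1,x_2),(y_1,y_2)\big) = (x_1y_1 - x_2y_2,\; x_1y_2 + x_2y_1),$$ $$F_{k+1}\big((x,x_{k+2}),(y,y_{k+2})\big) = \Big(F_k(x,y),\; x_{k+2}\,y + y_{k+2}\,x,\; \tau_{k+1}\big(\langle x,y\rangle - (k+1)x_{k+2}y_{k+2}\big)\Big),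 \qquad \tau_{k+1} = \sqrt{\tfrac{2}{(k+1)(k+2)}},$$ and let $\widetilde{\Phi} : \mathbb{R}^{m+1} \to \mathbb{R}^N$, $\widetilde{\Phi}(x) := \frac12\sqrt{\frac{m}{2(m+1)}}\,F_m(x,x)$. Since $\widetilde{\Phi}(-x) = \widetilde{\Phi}(x)$, it induces the maps $\Phi : \mathbb{RP}^m(r_m) \to \mathbb{R}^N$, $\Phi([x]) := \widetilde{\Phi}(x)$, and $\Phi_r : \mathbb{RP}^m(r) \to \mathbb{R}^N$, $\Phi_r([x]) := \frac{r_m}{r}\widetilde{\Phi}(x)$. Theorem. For every $[x] \in \mathbb{RP}^m(r_m)$, $$\Phi_r\Big(\frac{r}{r_m}[x]\Big) = \frac{r}{r_m}\,\Phi([x]).$$ Moreover, $\Phi_r$ takes its values in the sphere of radius $\frac{r}{r_m}$ about the origin of $\mathbb{R}^N$ and, as a map from $\mathbb{RP}^m(r)$ into this $(N-1)$-dimensional sphere with its round metric, it is an isometric embedding of Riemannian manifolds, that is, a smooth embedding whose differential preserves the Riemannian metrics. -/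

import Mathlib

open Metric Module Manifold Function Bundle Topology
open scoped ContDiff

noncomputable section

section PushForward

variable {E M N : Type*} [NormedAddCommGroup E] [NormedSpace ℝ E]
  [TopologicalSpace M] [ChartedSpace E M] [TopologicalSpace N] {f : M → N}

theorem pushforward_eventuallyEq (hf : IsLocalHomeomorph f) (x : M) {z w : M}
    (hw : w ∈ (hf.localInverseAt x).target) {σ : M → M} (hσ : ContinuousAt σ z)
    (hzw : σ z = w) (hfσ : ∀ y, f (σ y) = f y) :
    (fun y => hf.localInverseAt x (f y)) =ᶠ[𝓝 z] σ := by
  have h := hσ.preimage_mem_nhds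
    ((hf.localInverseAt x).open_target.mem_nhds (show σ z ∈ _ by rwa [hzw]))
  filter_upwards [h] with y hy
  rw [← hfσ y]
  have := (hf.localInverseAt x).right_inv hy
  rwa [hf.localInverseAt_symm] at this

theorem pushforward_isManifold (n : ℕ∞ω)
    (hf : IsLocalHomeomorph f) {g : N → M} (hg : RightInverse g f)
    [IsManifold 𝓘(ℝ, E) n M]
    (H₀ : ∀ x y, f x = f y →
      ∃ σ : M → M, ContMDiff 𝓘(ℝ, E) 𝓘(ℝ, E) n σ ∧ σ x = y ∧ ∀ z, f (σ z) = f z) :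
    letI := hf.chartedSpaceOfRightInverse (H := E) hg
    IsManifold 𝓘(ℝ, E) n N := by
  let := hf.chartedSpaceOfRightInverse (H := E) hg
  refine isManifold_of_contDiffOn 𝓘(ℝ, E) n N ?_
  rintro _ _ ⟨p, rfl⟩ ⟨q, rfl⟩
  intro u hu
  simp only [OpenPartialHomeomorph.trans_source, OpenPartialHomeomorph.symm_source,
    OpenPartialHomeomorph.trans_symm_eq_symm_trans_symm,
    OpenPartialHomeomorph.coe_trans, hf.localInverseAt_symm, modelWithCornersSelf_coe_symm,
    modelWithCornersSelf_coe, Set.mem_inter_iff, Set.mem_preimage, id, comp_apply] at hu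
  obtain ⟨⟨⟨hu1, hu2⟩, hu3, hu4⟩, -⟩ := hu
  have hfw := hf.apply_localInverseAt_of_mem hu3
  obtain ⟨σ, hσ, hσz, hfσ⟩ := H₀ _ _ hfw.symm
  have hev := pushforward_eventuallyEq hf (g q)
    ((hf.localInverseAt (g q)).map_source hu3) hσ.continuous.continuousAt hσz hfσ
  have h1 : ContMDiffAt 𝓘(ℝ, E) 𝓘(ℝ, E) n (chartAt E (g p)).symm u :=
    contMDiffOn_chart_symm.contMDiffAt ((chartAt E (g p)).open_target.mem_nhds hu1)
  have h2 : ContMDiffAt 𝓘(ℝ, E) 𝓘(ℝ, E) n (chartAt E (g q)) (σ ((chartAt E (g p)).symm u)) :=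
    contMDiffOn_chart.contMDiffAt ((chartAt E (g q)).open_source.mem_nhds (by rwa [hσz]))
  have h3 := h2.comp u ((hσ _).comp u h1)
  apply ContDiffAt.contDiffWithinAt
  rw [← contMDiffAt_iff_contDiffAt]
  refine h3.congr_of_eventuallyEq ?_
  have h4 := h1.continuousAt.tendsto.eventually hev
  filter_upwards [h4] with v hv
  simp [OpenPartialHomeomorph.trans_symm_eq_symm_trans_symm, hf.localInverseAt_symm, hv]

theorem pushforward_isLocalDiffeomorph (n : ℕ∞ω)
    (hf : IsLocalHomeomorph f) {g : N → M} (hg : RightInverse g f)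
    [IsManifold 𝓘(ℝ, E) n M]
    (H₀ : ∀ x y, f x = f y →
      ∃ σ : M → M, ContMDiff 𝓘(ℝ, E) 𝓘(ℝ, E) n σ ∧ σ x = y ∧ ∀ z, f (σ z) = f z) :
    letI := hf.chartedSpaceOfRightInverse (H := E) hg
    IsLocalDiffeomorph 𝓘(ℝ, E) 𝓘(ℝ, E) n f := by
  let := hf.chartedSpaceOfRightInverse (H := E) hg
  have := pushforward_isManifold n hf hg H₀
  -- the chosen local inverses are smooth near the point at which they are chosen
  have hL : ∀ x y, y ∈ (hf.localInverseAt x).source →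
      ContMDiffAt 𝓘(ℝ, E) 𝓘(ℝ, E) n (hf.localInverseAt x) y := by
    intro x y hy
    obtain ⟨σ, hσ, hσz, hfσ⟩ := H₀ (g y) (hf.localInverseAt x y)
      (by rw [hg y, hf.apply_localInverseAt_of_mem hy])
    have hev := pushforward_eventuallyEq hf x ((hf.localInverseAt x).map_source hy)
      hσ.continuous.continuousAt hσz hfσ
    have h1 : ContMDiffAt 𝓘(ℝ, E) 𝓘(ℝ, E) n (chartAt E y) y :=
      contMDiffOn_chart.contMDiffAt ((chartAt E y).open_source.mem_nhds (mem_chart_source E y))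
    have hy0 : hf.localInverseAt (g y) y = g y := by
      conv_lhs => rw [← hg y, hg y]
      have := hf.localInverseAt_apply_self (x := g y)
      rwa [hg y] at this
    have hcy : chartAt E y y = chartAt E (g y) (g y) := by
      change chartAt E (g y) (hf.localInverseAt (g y) y) = _
      rw [hy0]
    have h2 : ContMDiffAt 𝓘(ℝ, E) 𝓘(ℝ, E) n (chartAt E (g y)).symm (chartAt E y y) :=
      contMDiffOn_chart_symm.contMDiffAt ((chartAt E (g y)).open_target.mem_nhds
        (by rw [hcy]; exact mem_chart_target E (g y)))
    have h3 := (hσ _).comp y (h2.comp y h1)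
    refine h3.congr_of_eventuallyEq ?_
    have hcont : ContinuousAt (hf.localInverseAt (g y)) y :=
      (hf.localInverseAt (g y)).continuousAt (by
        have := hf.apply_self_mem_localInverseAt_source (x := g y)
        rwa [hg y] at this)
    have h5 : Filter.Tendsto (hf.localInverseAt (g y)) (𝓝 y) (𝓝 (g y)) := by
      have := hcont.tendsto
      rwa [hy0] at this
    have h6 := (chartAt E y).open_source.mem_nhds (mem_chart_source E y)
    filter_upwards [h5.eventually hev, h6] with v hv hv'
    have hv2 : v ∈ (hf.localInverseAt (g y)).source ∧
        hf.localInverseAt (g y) v ∈ (chartAt E (g y)).source := by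
      have : v ∈ ((hf.localInverseAt (g y)).trans (chartAt E (g y))).source := hv'
      simpa using this
    have h7 : (chartAt E (g y)).symm (chartAt E y v) = hf.localInverseAt (g y) v :=
      (chartAt E (g y)).left_inv hv2.2
    rw [hf.apply_localInverseAt_of_mem hv2.1] at hv
    simp only [comp_apply, h7, hv]
  have hF : ContMDiff 𝓘(ℝ, E) 𝓘(ℝ, E) n f := by
    intro x
    obtain ⟨σ, hσ, hσz, hfσ⟩ := H₀ x (g (f x)) (by rw [hg])
    have hev := pushforward_eventuallyEq hf (g (f x)) hf.self_mem_localInverseAt_target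
      hσ.continuous.continuousAt hσz hfσ
    rw [contMDiffAt_iff_target]
    refine ⟨hf.continuous.continuousAt, ?_⟩
    have h1 : ContMDiffAt 𝓘(ℝ, E) 𝓘(ℝ, E) n (chartAt E (g (f x))) (σ x) :=
      contMDiffOn_chart.contMDiffAt ((chartAt E (g (f x))).open_source.mem_nhds
        (by rw [hσz]; exact mem_chart_source E _))
    refine (h1.comp x (hσ x)).congr_of_eventuallyEq ?_
    filter_upwards [hev] with v hv
    change chartAt E (g (f x)) (hf.localInverseAt (g (f x)) (f v)) = _
    rw [hv]; rfl
  intro x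
  refine ⟨⟨(hf.localInverseAt x).symm.toPartialEquiv, (hf.localInverseAt x).open_target,
    (hf.localInverseAt x).open_source, ?_, ?_⟩, hf.self_mem_localInverseAt_target, ?_⟩
  · exact (hF.contMDiffOn (s := (hf.localInverseAt x).target)).congr
      (fun y _ => by exact congrFun (hf.localInverseAt_symm x) y)
  · intro y hy
    exact (hL x y hy).contMDiffWithinAt
  · intro y _
    exact (congrFun (hf.localInverseAt_symm x) y).symm

end PushForward

/-! ### Spheres of arbitrary radius -/

/-- The sphere of radius `r` about the origin of `V`, as a space of its own: it carries the
smooth structure defined below (Mathlib treats only radius `1`). -/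
def RSphere (V : Type*) [NormedAddCommGroup V] (r : ℝ) : Type _ := sphere (0 : V) r

namespace RSphere

section Basic

variable {V : Type*} [NormedAddCommGroup V] {r : ℝ}

instance : TopologicalSpace (RSphere V r) := inferInstanceAs (TopologicalSpace (sphere (0 : V) r))

instance : T2Space (RSphere V r) := inferInstanceAs (T2Space (sphere (0 : V) r))

instance : InvolutiveNeg (RSphere V r) := inferInstanceAs (InvolutiveNeg (sphere (0 : V) r))

/-- The inclusion of the sphere in the ambient space. -/
def val (x : RSphere V r) : V := Subtype.val x

/-- A vector of norm `r` as a point of the sphere. -/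
def mk (v : V) (hv : ‖v‖ = r) : RSphere V r := ⟨v, mem_sphere_zero_iff_norm.2 hv⟩

theorem norm_val (x : RSphere V r) : ‖x.val‖ = r := mem_sphere_zero_iff_norm.1 x.2

theorem val_mk (v : V) (hv : ‖v‖ = r) : (mk v hv).val = v := rfl

theorem val_neg (x : RSphere V r) : (-x).val = -x.val := rfl

theorem val_injective : Injective (val : RSphere V r → V) := Subtype.val_injective

theorem continuous_val : Continuous (val : RSphere V r → V) := continuous_subtype_val

/-- Rescaling is a homeomorphism from the unit sphere onto the sphere of radius `r > 0`. -/
def ofUnit (V : Type*) [NormedAddCommGroup V] [NormedSpace ℝ V] (r : ℝ) [hr : Fact (0 < r)] :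
    sphere (0 : V) 1 ≃ₜ RSphere V r where
  toFun x := mk (r • (x : V)) (by simp [norm_smul, abs_of_pos hr.out])
  invFun y := ⟨r⁻¹ • y.val, by
    simp [norm_smul, abs_of_pos hr.out, norm_val, inv_mul_cancel₀ hr.out.ne']⟩
  left_inv x := by
    apply Subtype.ext
    change r⁻¹ • r • (x : V) = x
    rw [inv_smul_smul₀ hr.out.ne']
  right_inv y := by
    apply val_injective
    change r • r⁻¹ • y.val = y.val
    rw [smul_inv_smul₀ hr.out.ne']
  continuous_toFun := Continuous.subtype_mk (by fun_prop) _
  continuous_invFun := Continuous.subtype_mk (continuous_val.const_smul _) _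

end Basic

section Smooth

variable {V : Type*} [NormedAddCommGroup V] [InnerProductSpace ℝ V] {n : ℕ}
  [Fact (finrank ℝ V = n + 1)] {r : ℝ} [hr : Fact (0 < r)]

/-- The charts of the sphere of radius `r` are those of the unit sphere, rescaled. -/
instance : ChartedSpace (EuclideanSpace ℝ (Fin n)) (RSphere V r) :=
  (ofUnit V r).isLocalHomeomorph.chartedSpaceOfRightInverse (ofUnit V r).right_inv

theorem ofUnit_lift (k : ℕ∞ω) (x y : sphere (0 : V) 1) (h : ofUnit V r x = ofUnit V r y) :
    ∃ σ : sphere (0 : V) 1 → sphere (0 : V) 1,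
      ContMDiff (𝓡 n) (𝓡 n) k σ ∧ σ x = y ∧ ∀ z, ofUnit V r (σ z) = ofUnit V r z :=
  ⟨id, contMDiff_id, (ofUnit V r).injective h, fun _ => rfl⟩

instance : IsManifold (𝓡 n) ω (RSphere V r) :=
  pushforward_isManifold ω (ofUnit V r).isLocalHomeomorph (ofUnit V r).right_inv (ofUnit_lift ω)

theorem isLocalDiffeomorph_ofUnit : IsLocalDiffeomorph (𝓡 n) (𝓡 n) ω (ofUnit V r) :=
  pushforward_isLocalDiffeomorph ω (ofUnit V r).isLocalHomeomorph (ofUnit V r).right_inv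
    (ofUnit_lift ω)

theorem contMDiff_ofUnit_symm : ContMDiff (𝓡 n) (𝓡 n) ω (ofUnit V r).symm := by
  intro x
  obtain ⟨y, rfl⟩ := (ofUnit V r).surjective x
  have h := isLocalDiffeomorph_ofUnit (V := V) (r := r) (n := n) y
  refine h.localInverse_contMDiffAt.congr_of_eventuallyEq ?_
  filter_upwards [h.localInverse_eventuallyEq_right] with z hz
  rw [(ofUnit V r).symm_apply_eq]
  exact hz.symm

theorem val_eq : (val : RSphere V r → V) =
    fun y => r • (((↑) : sphere (0 : V) 1 → V) ((ofUnit V r).symm y)) := by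
  funext y
  change y.val = r • r⁻¹ • y.val
  rw [smul_inv_smul₀ hr.out.ne']

theorem contMDiff_val : ContMDiff (𝓡 n) 𝓘(ℝ, V) ω (val : RSphere V r → V) := by
  rw [val_eq]
  exact (contDiff_const_smul r).contMDiff.comp
    (contMDiff_coe_sphere.comp (contMDiff_ofUnit_symm (n := n)))

theorem contMDiff_codRestrict {F M : Type*} [NormedAddCommGroup F] [NormedSpace ℝ F]
    [TopologicalSpace M] [ChartedSpace F M] {k : ℕ∞ω} [IsManifold 𝓘(ℝ, F) k M] {f : M → RSphere V r}
    (hf : ContMDiff 𝓘(ℝ, F) 𝓘(ℝ, V) k (fun x => (f x).val)) : ContMDiff 𝓘(ℝ, F) (𝓡 n) k f := by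
  have h1 : ContMDiff 𝓘(ℝ, F) 𝓘(ℝ, V) k (fun x => r⁻¹ • (f x).val) :=
    (contDiff_const_smul r⁻¹).contMDiff.comp hf
  have h2 := ContMDiff.codRestrict_sphere (n := n) h1 (fun x => ((ofUnit V r).symm (f x)).2)
  have h3 := (isLocalDiffeomorph_ofUnit (V := V) (r := r) (n := n)).contMDiff.of_le
    (show k ≤ ω from le_top) |>.comp h2
  convert h3 using 1
  funext x
  exact ((ofUnit V r).apply_symm_apply (f x)).symm

theorem contMDiff_neg : ContMDiff (𝓡 n) (𝓡 n) ω (fun x : RSphere V r => -x) := by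
  apply contMDiff_codRestrict
  exact contDiff_neg.contMDiff.comp contMDiff_val

theorem injective_mvfderiv_val (x : RSphere V r) :
    Injective (mvfderiv (𝓡 n) (val : RSphere V r → V) x) := by
  obtain ⟨y, rfl⟩ := (ofUnit V r).surjective x
  have hv : MDifferentiableAt (𝓡 n) 𝓘(ℝ, V) (val : RSphere V r → V) (ofUnit V r y) :=
    contMDiff_val.mdifferentiableAt (by simp)
  have hu := isLocalDiffeomorph_ofUnit (V := V) (r := r) (n := n) y
  have hvu := hv.comp y (hu.mdifferentiableAt (by simp))
  have hs : MDifferentiableAt 𝓘(ℝ, V) 𝓘(ℝ, V) (fun v : V => r⁻¹ • v)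
      (((val : RSphere V r → V) ∘ ofUnit V r) y) :=
    (contDiff_const_smul (n := 1) r⁻¹).contMDiff.mdifferentiableAt (by simp)
  have e : ((↑) : sphere (0 : V) 1 → V) =
      (fun v : V => r⁻¹ • v) ∘ ((val : RSphere V r → V) ∘ ofUnit V r) := by
    funext z
    change (z : V) = r⁻¹ • r • (z : V)
    rw [inv_smul_smul₀ hr.out.ne']
  have inj := injective_mvfderiv_subtypeVal_sphere (n := n) y
  have d1 := mfderiv_comp y hs hvu
  have d2 := mfderiv_comp y hv (hu.mdifferentiableAt (by simp))
  have inj1 : Injective (mfderiv (𝓡 n) 𝓘(ℝ, V) ((val : RSphere V r → V) ∘ ofUnit V r) y) := by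
    refine Injective.of_comp (f := mfderiv 𝓘(ℝ, V) 𝓘(ℝ, V) (fun v : V => r⁻¹ • v) _) ?_
    rw [e] at inj
    have : Injective (mfderiv (𝓡 n) 𝓘(ℝ, V) ((fun v : V => r⁻¹ • v) ∘
      ((val : RSphere V r → V) ∘ ofUnit V r)) y) := inj
    rw [d1] at this
    exact this
  rw [d2] at inj1
  intro a b hab
  let D := hu.mfderivToContinuousLinearEquiv (by simp)
  obtain ⟨a, rfl⟩ := D.surjective a
  obtain ⟨b, rfl⟩ := D.surjective b
  exact congrArg D (inj1 hab)

end Smooth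

end RSphere

/-! ### Riemannian metrics induced by immersions -/

/-- The Riemannian metric `⟨v, w⟩ₓ = ⟨A x v, A x w⟩` pulled back from the inner product space `F`
along a family `A` of injective linear maps from the tangent spaces of `M` to `F`. -/
def pullbackMetric {n : ℕ} {M F : Type*} [TopologicalSpace M]
    [ChartedSpace (EuclideanSpace ℝ (Fin n)) M] [NormedAddCommGroup F] [InnerProductSpace ℝ F]
    (A : ∀ x : M, TangentSpace (𝓡 n) x →L[ℝ] F) (hA : ∀ x, Injective (A x)) :
    RiemannianMetric (fun x : M => TangentSpace (𝓡 n) x) where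
  inner x := (ContinuousLinearMap.precomp ℝ (A x)).comp ((innerSL ℝ (E := F)).comp (A x))
  symm x v w := real_inner_comm _ _
  pos x v hv := real_inner_self_pos.2 fun h => hv (hA x (h.trans (map_zero _).symm))
  continuousAt x := by
    have : Continuous fun v : TangentSpace (𝓡 n) x => inner ℝ (A x v) (A x v) :=
      (A x).continuous.inner (A x).continuous
    exact this.continuousAt
  isVonNBounded x := by
    let B : EuclideanSpace ℝ (Fin n) →L[ℝ] F := A x
    change Bornology.IsVonNBounded ℝ {v : EuclideanSpace ℝ (Fin n) | inner ℝ (B v) (B v) < 1}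
    obtain ⟨K, -, hK⟩ := B.toLinearMap.exists_antilipschitzWith (LinearMap.ker_eq_bot.2 (hA x))
    rw [NormedSpace.isVonNBounded_iff']
    refine ⟨K, fun v hv => ?_⟩
    have h1 := hK.le_mul_dist v 0
    have h2 : ‖B v‖ ≤ 1 := by
      have hv' : inner ℝ (B v) (B v) < 1 := hv
      rw [real_inner_self_eq_norm_sq] at hv'
      nlinarith [norm_nonneg (B v)]
    simp only [map_zero, dist_zero_right] at h1
    exact h1.trans (mul_le_of_le_one_right K.2 h2)

theorem pullbackMetric_inner {n : ℕ} {M F : Type*} [TopologicalSpace M]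
    [ChartedSpace (EuclideanSpace ℝ (Fin n)) M] [NormedAddCommGroup F] [InnerProductSpace ℝ F]
    (A : ∀ x : M, TangentSpace (𝓡 n) x →L[ℝ] F) (hA : ∀ x, Injective (A x)) (x : M)
    (v w : TangentSpace (𝓡 n) x) :
    (pullbackMetric A hA).inner x v w = inner ℝ (A x v) (A x w) := rfl

/-- The round metric of the sphere: tangent vectors are measured in the ambient space. -/
def RSphere.metric {V : Type*} [NormedAddCommGroup V] [InnerProductSpace ℝ V] {n : ℕ}
    [Fact (finrank ℝ V = n + 1)] {r : ℝ} [Fact (0 < r)] :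
    RiemannianMetric (fun x : RSphere V r => TangentSpace (𝓡 n) x) :=
  pullbackMetric (fun x => mvfderiv (𝓡 n) RSphere.val x) RSphere.injective_mvfderiv_val

theorem RSphere.metric_neg {V : Type*} [NormedAddCommGroup V] [InnerProductSpace ℝ V] {n : ℕ}
    [Fact (finrank ℝ V = n + 1)] {r : ℝ} [Fact (0 < r)] (x : RSphere V r)
    (v w : TangentSpace (𝓡 n) x) :
    RSphere.metric.inner (-x) (mfderiv (𝓡 n) (𝓡 n) (fun y : RSphere V r => -y) x v)
      (mfderiv (𝓡 n) (𝓡 n) (fun y : RSphere V r => -y) x w) = RSphere.metric.inner x v w := by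
  have h1 : MDifferentiableAt (𝓡 n) (𝓡 n) (fun y : RSphere V r => -y) x :=
    RSphere.contMDiff_neg.mdifferentiableAt (by simp)
  have h2 : MDifferentiableAt (𝓡 n) 𝓘(ℝ, V) (RSphere.val : RSphere V r → V) (-x) :=
    RSphere.contMDiff_val.mdifferentiableAt (by simp)
  have e : (RSphere.val : RSphere V r → V) ∘ (fun y => -y) = -RSphere.val := rfl
  have h3 : mvfderiv (𝓡 n) ((RSphere.val : RSphere V r → V) ∘ (fun y => -y)) x = _ :=
    mfderiv_comp x h2 h1
  rw [e, mvfderiv_neg] at h3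
  have h4 : ∀ v, mvfderiv (𝓡 n) (RSphere.val : RSphere V r → V) (-x)
      (mfderiv (𝓡 n) (𝓡 n) (fun y : RSphere V r => -y) x v) =
      -mvfderiv (𝓡 n) (RSphere.val : RSphere V r → V) x v :=
    fun v => (congrArg (fun L : TangentSpace (𝓡 n) x →L[ℝ] V => L v) h3).symm
  change inner ℝ (mvfderiv (𝓡 n) (RSphere.val : RSphere V r → V) (-x) _)
      (mvfderiv (𝓡 n) (RSphere.val : RSphere V r → V) (-x) _) =
    inner ℝ (mvfderiv (𝓡 n) (RSphere.val : RSphere V r → V) x v)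
      (mvfderiv (𝓡 n) (RSphere.val : RSphere V r → V) x w)
  rw [h4, h4, inner_neg_neg]

/-! ### Real projective spaces -/

instance fact_finrank_euclideanSpace (m : ℕ) :
    Fact (finrank ℝ (EuclideanSpace ℝ (Fin (m + 1))) = m + 1) :=
  ⟨finrank_euclideanSpace_fin⟩

/-- The relation `x ∼ y ↔ x = y ∨ x = -y` on the sphere of radius `r` in `ℝ^(m+1)`. -/
def antipodalSetoid (m : ℕ) (r : ℝ) : Setoid (RSphere (EuclideanSpace ℝ (Fin (m + 1))) r) where
  r x y := x = y ∨ x = -y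
  iseqv :=
    { refl := fun _ => Or.inl rfl
      symm := by
        rintro x y (rfl | rfl)
        · exact Or.inl rfl
        · exact Or.inr (neg_neg y).symm
      trans := by
        rintro x y z (rfl | rfl) (rfl | rfl)
        · exact Or.inl rfl
        · exact Or.inr rfl
        · exact Or.inr rfl
        · exact Or.inl (neg_neg z) }

/-- The real projective space `ℝP^m(r)` of radius `r`. -/
def RP (m : ℕ) (r : ℝ) : Type := Quotient (antipodalSetoid m r)

namespace RP

variable {m : ℕ} {r : ℝ}

/-- The quotient map `x ↦ [x]` from the sphere to the projective space. -/
def mk (x : RSphere (EuclideanSpace ℝ (Fin (m + 1))) r) : RP m r := Quotient.mk _ x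

/-- The quotient topology. -/
instance : TopologicalSpace (RP m r) :=
  inferInstanceAs (TopologicalSpace (Quotient (antipodalSetoid m r)))

theorem mk_eq_mk {x y : RSphere (EuclideanSpace ℝ (Fin (m + 1))) r} :
    mk x = mk y ↔ x = y ∨ x = -y := Quotient.eq (r := antipodalSetoid m r)

theorem mk_neg (x : RSphere (EuclideanSpace ℝ (Fin (m + 1))) r) : mk (-x) = mk x :=
  mk_eq_mk.2 (Or.inr rfl)

/-- A representative of a point of the projective space. -/
def out (p : RP m r) : RSphere (EuclideanSpace ℝ (Fin (m + 1))) r := Quotient.out p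

theorem mk_out (p : RP m r) : mk p.out = p := Quotient.out_eq p

theorem continuous_mk : Continuous (mk : _ → RP m r) := continuous_quotient_mk'

theorem continuous_neg_sphere :
    Continuous (fun x : RSphere (EuclideanSpace ℝ (Fin (m + 1))) r => -x) :=
  Continuous.subtype_mk (RSphere.continuous_val.neg) _

theorem isOpenMap_mk : IsOpenMap (mk : _ → RP m r) := by
  intro U hU
  have h : mk ⁻¹' ((mk : _ → RP m r) '' U) = U ∪ (fun x => -x) ⁻¹' U := by
    ext x
    constructor
    · rintro ⟨y, hy, hxy⟩
      rcases mk_eq_mk.1 hxy with rfl | rfl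
      · exact Or.inl hy
      · exact Or.inr hy
    · rintro (hx | hx)
      · exact ⟨x, hx, rfl⟩
      · exact ⟨-x, hx, mk_neg x⟩
  have h2 : IsOpen (mk ⁻¹' ((mk : _ → RP m r) '' U)) := by
    rw [h]
    exact hU.union (hU.preimage continuous_neg_sphere)
  exact h2

theorem isLocalHomeomorph_mk [hr : Fact (0 < r)] : IsLocalHomeomorph (mk : _ → RP m r) := by
  rw [isLocalHomeomorph_iff_isOpenEmbedding_restrict]
  intro x
  have hopen : IsOpen {y : RSphere (EuclideanSpace ℝ (Fin (m + 1))) r |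
      y.val ∈ ball x.val r} := isOpen_ball.preimage RSphere.continuous_val
  refine ⟨_, hopen.mem_nhds (mem_ball_self hr.out), ?_⟩
  refine IsOpenEmbedding.of_continuous_injective_isOpenMap
    (continuous_mk.comp continuous_subtype_val) ?_
    (isOpenMap_mk.comp hopen.isOpenMap_subtype_val)
  rintro ⟨y, hy⟩ ⟨z, hz⟩ hyz
  rcases mk_eq_mk.1 hyz with h | h
  · exact Subtype.ext h
  · exfalso
    have h1 : ‖y.val - z.val‖ < r + r := by
      rw [← dist_eq_norm]
      exact (dist_triangle_right _ _ x.val).trans_lt (add_lt_add hy hz)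
    rw [show y = -z from h, RSphere.val_neg, ← neg_add', norm_neg, ← two_smul ℝ, norm_smul, RSphere.norm_val] at h1
    norm_num at h1
    linarith

section Smooth

variable [hr : Fact (0 < r)]

/-- The charts of the projective space are the charts of the sphere composed with local inverses
of the quotient map. -/
instance : ChartedSpace (EuclideanSpace ℝ (Fin m)) (RP m r) :=
  isLocalHomeomorph_mk.chartedSpaceOfRightInverse mk_out

theorem mk_lift (k : ℕ∞ω) (x y : RSphere (EuclideanSpace ℝ (Fin (m + 1))) r)
    (h : mk x = mk y) :
    ∃ σ : RSphere (EuclideanSpace ℝ (Fin (m + 1))) r → RSphere (EuclideanSpace ℝ (Fin (m + 1))) r,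
      ContMDiff (𝓡 m) (𝓡 m) k σ ∧ σ x = y ∧ ∀ z, mk (σ z) = mk z := by
  rcases mk_eq_mk.1 h with rfl | rfl
  · exact ⟨id, contMDiff_id, rfl, fun _ => rfl⟩
  · exact ⟨fun z => -z, RSphere.contMDiff_neg.of_le le_top, neg_neg y, mk_neg⟩

instance : IsManifold (𝓡 m) ω (RP m r) :=
  pushforward_isManifold ω isLocalHomeomorph_mk mk_out (mk_lift ω)

/-- The quotient map is a local diffeomorphism. -/
theorem isLocalDiffeomorph_mk : IsLocalDiffeomorph (𝓡 m) (𝓡 m) ω (mk : _ → RP m r) :=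
  pushforward_isLocalDiffeomorph ω isLocalHomeomorph_mk mk_out (mk_lift ω)

/-- The inverse of the differential of the quotient map at the chosen representative of `p`. -/
def tangentLift (p : RP m r) : TangentSpace (𝓡 m) p →L[ℝ] TangentSpace (𝓡 m) p.out :=
  let D := (isLocalDiffeomorph_mk p.out).mfderivToContinuousLinearEquiv
    (show (ω : ℕ∞ω) ≠ 0 by simp)
  let L : EuclideanSpace ℝ (Fin m) →L[ℝ] EuclideanSpace ℝ (Fin m) :=
    D.symm.toContinuousLinearMap
  L

theorem injective_tangentLift (p : RP m r) : Injective (tangentLift p) :=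
  ((isLocalDiffeomorph_mk p.out).mfderivToContinuousLinearEquiv
    (show (ω : ℕ∞ω) ≠ 0 by simp)).symm.injective

/-- The canonical Riemannian metric of the projective space, inherited from the round metric of
the sphere: `g_p(v, w) = g_x(dπₓ⁻¹ v, dπₓ⁻¹ w)` for a representative `x` of `p`. It does not
depend on the representative: see `metric_mk`. -/
def metric : RiemannianMetric (fun p : RP m r => TangentSpace (𝓡 m) p) :=
  pullbackMetric (fun p => (mvfderiv (𝓡 m) RSphere.val p.out).comp (tangentLift p))
    (fun p => (RSphere.injective_mvfderiv_val p.out).comp (injective_tangentLift p))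

theorem metric_mk_out (p : RP m r) (v w : TangentSpace (𝓡 m) p.out) :
    metric.inner (mk p.out) (mfderiv (𝓡 m) (𝓡 m) mk p.out v) (mfderiv (𝓡 m) (𝓡 m) mk p.out w) =
      RSphere.metric.inner p.out v w := by
  have key : ∀ (q : RP m r) (hq : q = p) (v w : EuclideanSpace ℝ (Fin m)),
      (metric.inner q : EuclideanSpace ℝ (Fin m) →L[ℝ] EuclideanSpace ℝ (Fin m) →L[ℝ] ℝ) v w =
      (metric.inner p : EuclideanSpace ℝ (Fin m) →L[ℝ] EuclideanSpace ℝ (Fin m) →L[ℝ] ℝ) v w := by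
    rintro q rfl v w; rfl
  refine (key _ (mk_out p) _ _).trans ?_
  have h : ∀ v : TangentSpace (𝓡 m) p.out,
      tangentLift p (mfderiv (𝓡 m) (𝓡 m) mk p.out v) = v := fun v =>
    ((isLocalDiffeomorph_mk p.out).mfderivToContinuousLinearEquiv
      (show (ω : ℕ∞ω) ≠ 0 by simp)).symm_apply_apply v
  change inner ℝ (mvfderiv (𝓡 m) RSphere.val p.out
      (tangentLift p (mfderiv (𝓡 m) (𝓡 m) mk p.out v)))
    (mvfderiv (𝓡 m) RSphere.val p.out (tangentLift p (mfderiv (𝓡 m) (𝓡 m) mk p.out w))) = _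
  rw [h, h]
  rfl

/-- The quotient map is a local isometry from the round sphere. -/
theorem metric_mk (x : RSphere (EuclideanSpace ℝ (Fin (m + 1))) r) (v w : TangentSpace (𝓡 m) x) :
    metric.inner (mk x) (mfderiv (𝓡 m) (𝓡 m) mk x v) (mfderiv (𝓡 m) (𝓡 m) mk x w) =
      RSphere.metric.inner x v w := by
  rcases mk_eq_mk.1 (mk_out (mk x)) with h | h
  · have key := metric_mk_out (mk x)
    rw [h] at key
    exact key v w
  · have key := metric_mk_out (mk x)
    rw [h] at key
    have h1 : MDifferentiableAt (𝓡 m) (𝓡 m)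
        (fun y : RSphere (EuclideanSpace ℝ (Fin (m + 1))) r => -y) x :=
      RSphere.contMDiff_neg.mdifferentiableAt (by simp)
    have h2 : MDifferentiableAt (𝓡 m) (𝓡 m) (mk : _ → RP m r) (-x) :=
      (isLocalDiffeomorph_mk (-x)).mdifferentiableAt (by simp)
    have h3 := mfderiv_comp x h2 h1
    have e : (mk : _ → RP m r) ∘ (fun y => -y) = mk := funext mk_neg
    rw [e] at h3
    rw [← RSphere.metric_neg x v w, ← key, h3]
    have key2 : ∀ (p q : RP m r) (_ : q = p) (v w : EuclideanSpace ℝ (Fin m)),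
      (metric.inner q : EuclideanSpace ℝ (Fin m) →L[ℝ] EuclideanSpace ℝ (Fin m) →L[ℝ] ℝ) v w =
      (metric.inner p : EuclideanSpace ℝ (Fin m) →L[ℝ] EuclideanSpace ℝ (Fin m) →L[ℝ] ℝ) v w := by
      rintro p q rfl v w; rfl
    exact key2 _ _ (mk_neg x).symm _ _

end Smooth

/-- Multiplication of `[x] ∈ ℝP^m(s)` by `r / s`, with values in `ℝP^m(r)`. -/
def rescale (s r : ℝ) [hs : Fact (0 < s)] [hr : Fact (0 < r)] (p : RP m s) : RP m r :=
  Quotient.map (sa := antipodalSetoid m s) (sb := antipodalSetoid m r)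
    (fun x => RSphere.mk ((r / s) • x.val) (by
      rw [norm_smul, x.norm_val, Real.norm_eq_abs, abs_of_pos (div_pos hr.out hs.out),
        div_mul_cancel₀ _ hs.out.ne']))
    (by
      rintro x y (rfl | rfl)
      · exact Or.inl rfl
      · exact Or.inr (RSphere.val_injective (smul_neg _ _))) p

end RP

/-! ### The embedding -/

/-- An isometric embedding of Riemannian manifolds: a smooth embedding whose differential
preserves the metrics. -/
structure IsIsometricEmbedding {k l : ℕ} {M N : Type*} [TopologicalSpace M]
    [ChartedSpace (EuclideanSpace ℝ (Fin k)) M] [TopologicalSpace N]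
    [ChartedSpace (EuclideanSpace ℝ (Fin l)) N]
    (gM : RiemannianMetric (fun x : M => TangentSpace (𝓡 k) x))
    (gN : RiemannianMetric (fun y : N => TangentSpace (𝓡 l) y)) (f : M → N) : Prop where
  isSmoothEmbedding : IsSmoothEmbedding (𝓡 k) (𝓡 l) ∞ f
  inner_mfderiv : ∀ (x : M) (v w : TangentSpace (𝓡 k) x),
    gN.inner (f x) (mfderiv (𝓡 k) (𝓡 l) f x v) (mfderiv (𝓡 k) (𝓡 l) f x w) = gM.inner x v w

/-- The vector of all coordinates of `x ∈ ℝ^(k+1)` but the last. -/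
def dropLast {k : ℕ} (x : EuclideanSpace ℝ (Fin (k + 1))) : EuclideanSpace ℝ (Fin k) :=
  WithLp.toLp 2 fun i => x i.castSucc

/-- The recursively defined bilinear maps `F_m : ℝ^(m+1) × ℝ^(m+1) → ℝ^(m(m+3)/2)`. The recursion
starts at `m = 1`; the value at `m = 0` is a placeholder. -/
def veroneseF : (m : ℕ) → EuclideanSpace ℝ (Fin (m + 1)) → EuclideanSpace ℝ (Fin (m + 1)) →
    EuclideanSpace ℝ (Fin (m * (m + 3) / 2))
  | 0, _, _ => 0
  | 1, x, y => !₂[x 0 * y 0 - x 1 * y 1, x 0 * y 1 + x 1 * y 0]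
  | m + 2, x, y =>
    have h : (m + 2) * (m + 2 + 3) / 2 = (m + 1) * (m + 1 + 3) / 2 + (m + 2) + 1 := by
      rw [show (m + 2) * (m + 2 + 3) = (m + 1) * (m + 1 + 3) + (m + 3) * 2 by ring,
        Nat.add_mul_div_right _ _ two_pos]
      omega
    WithLp.toLp 2 fun i =>
      (Fin.snoc (α := fun _ => ℝ)
        (Fin.append (veroneseF (m + 1) (dropLast x) (dropLast y)).ofLp
          (x (Fin.last (m + 2)) • dropLast y + y (Fin.last (m + 2)) • dropLast x).ofLp)
        (√(2 / (((m : ℝ) + 2) * (m + 3))) * (inner ℝ (dropLast x) (dropLast y) -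
          ((m : ℝ) + 2) * (x (Fin.last (m + 2)) * y (Fin.last (m + 2))))) :
        Fin ((m + 1) * (m + 1 + 3) / 2 + (m + 2) + 1) → ℝ) (Fin.cast h i)

theorem veroneseF_neg_neg : ∀ (m : ℕ) (x y : EuclideanSpace ℝ (Fin (m + 1))),
    veroneseF m (-x) (-y) = veroneseF m x y
  | 0, _, _ => rfl
  | 1, x, y => by simp [veroneseF]
  | m + 2, x, y => by
    have hd : ∀ z : EuclideanSpace ℝ (Fin (m + 2 + 1)), dropLast (-z) = -dropLast z := fun _ => rfl
    simp only [veroneseF, hd, veroneseF_neg_neg (m + 1), inner_neg_neg, PiLp.neg_apply, smul_neg,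
      neg_smul, neg_neg, neg_mul_neg]

/-- The radius `r_m = √(2(m+1)/m)`. -/
def radius (m : ℕ) : ℝ := √(2 * ((m : ℝ) + 1) / m)

/-- The extension `Φ̃ x = ½ √(m / (2(m+1))) F_m(x, x)` of `Φ` to all of `ℝ^(m+1)`. -/
def PhiTilde (m : ℕ) (x : EuclideanSpace ℝ (Fin (m + 1))) :
    EuclideanSpace ℝ (Fin (m * (m + 3) / 2)) :=
  (1 / 2 * √((m : ℝ) / (2 * ((m : ℝ) + 1)))) • veroneseF m x x

/-- The function induced by `Φ̃` on the projective space of radius `r`. -/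
def PhiTildeRP (m : ℕ) (r : ℝ) (p : RP m r) : EuclideanSpace ℝ (Fin (m * (m + 3) / 2)) :=
  Quotient.lift (s := antipodalSetoid m r) (fun x => PhiTilde m x.val) (by
    rintro x y (rfl | rfl)
    · rfl
    · simp only [RSphere.val_neg, PhiTilde, veroneseF_neg_neg]) p

/-- The map `Φ([x]) = ½ √(m / (2(m+1))) F_m(x, x)` on `ℝP^m(r_m)`. -/
def Phi (m : ℕ) : RP m (radius m) → EuclideanSpace ℝ (Fin (m * (m + 3) / 2)) :=
  PhiTildeRP m (radius m)

/-- The rescaled map `Φ_r = (r_m / r) Φ̃` on `ℝP^m(r)`. -/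
def PhiR (m : ℕ) (r : ℝ) (p : RP m r) : EuclideanSpace ℝ (Fin (m * (m + 3) / 2)) :=
  (radius m / r) • PhiTildeRP m r p

instance fact_radius_pos (m : ℕ) [NeZero m] : Fact (0 < radius m) :=
  ⟨Real.sqrt_pos.2 (by have := Nat.pos_of_neZero m; positivity)⟩

instance fact_div_pos (a b : ℝ) [ha : Fact (0 < a)] [hb : Fact (0 < b)] : Fact (0 < a / b) :=
  ⟨div_pos ha.out hb.out⟩

instance fact_finrank_target (m : ℕ) [NeZero m] :
    Fact (finrank ℝ (EuclideanSpace ℝ (Fin (m * (m + 3) / 2))) = m * (m + 3) / 2 - 1 + 1) :=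
  ⟨by
    rw [finrank_euclideanSpace_fin]
    have h1 : 0 < m := Nat.pos_of_neZero m
    have h2 : 2 ≤ m * (m + 3) := by nlinarith
    omega⟩

end

/-!
The map `Φ_r` is the Veronese embedding. The whole computation rests on one identity,
`inner_veroneseF`:

  `⟪F_m(x, y), F_m(z, w)⟫ = ⟪x, z⟫⟪y, w⟫ + ⟪x, w⟫⟪y, z⟫ - 2/(m+1) ⟪x, y⟫⟪z, w⟫`,

which follows from the recursion for `F_m` by induction. Bilinearity and symmetry of `F_m` are read
off from it, because the squared norm of a combination of values of `F_m` is determined by their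
inner products. On vectors of norm `r`,

* `‖F_m(x, x)‖² = 2m/(m+1) r⁴`, which gives the radius of the target sphere (`norm_PhiR`);
* `F_m(x, x) = F_m(y, y)` forces `⟪x, y⟫² = r⁴`, hence `x = y` or `x = -y` (`injective_PhiR`);
* the differential of `x ↦ Φ_r([x])` is `v ↦ F_m(x, v) / r`, and for `v, w` orthogonal to `x` one
  has `⟪F_m(x, v), F_m(x, w)⟫ = r² ⟪v, w⟫`, so the metrics are preserved (`inner_mvfderiv_PhiR`).

In particular the differential is injective. Since an immersion is by definition a map that is a
linear inclusion in suitable charts, the immersion theorem is proved here from the inverse function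
theorem (`isImmersionAtOfComplement_of_injective_mfderiv`). Finally `Φ_r` is a continuous injection
of a compact space into a Hausdorff space, hence a topological embedding.
-/

/-! ### The bilinear maps `F_m` -/

theorem inner_eq_inner_dropLast_add {k : ℕ} (x y : EuclideanSpace ℝ (Fin (k + 1))) :
    inner ℝ x y = inner ℝ (dropLast x) (dropLast y) + x (Fin.last k) * y (Fin.last k) := by
  simp only [PiLp.inner_apply, Fin.sum_univ_castSucc, dropLast]
  simp [mul_comm]

/-- The recursion step of the definition of `F_m`, for inner products: the three blocks of
coordinates are orthogonal to one another. -/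
theorem inner_veroneseF_add_two (m : ℕ) (x y z w : EuclideanSpace ℝ (Fin (m + 2 + 1))) :
    inner ℝ (veroneseF (m + 2) x y) (veroneseF (m + 2) z w) =
      inner ℝ (veroneseF (m + 1) (dropLast x) (dropLast y))
        (veroneseF (m + 1) (dropLast z) (dropLast w)) +
      inner ℝ (x (Fin.last (m + 2)) • dropLast y + y (Fin.last (m + 2)) • dropLast x)
        (z (Fin.last (m + 2)) • dropLast w + w (Fin.last (m + 2)) • dropLast z) +
      2 / (((m : ℝ) + 2) * (m + 3)) *
        ((inner ℝ (dropLast x) (dropLast y) -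
          ((m : ℝ) + 2) * (x (Fin.last (m + 2)) * y (Fin.last (m + 2)))) *
        (inner ℝ (dropLast z) (dropLast w) -
          ((m : ℝ) + 2) * (z (Fin.last (m + 2)) * w (Fin.last (m + 2))))) := by
  have h : (m + 2) * (m + 2 + 3) / 2 = (m + 1) * (m + 1 + 3) / 2 + (m + 2) + 1 := by
    rw [show (m + 2) * (m + 2 + 3) = (m + 1) * (m + 1 + 3) + (m + 3) * 2 by ring,
      Nat.add_mul_div_right _ _ two_pos]
    omega
  have hτ : √(2 / (((m : ℝ) + 2) * (m + 3))) * √(2 / (((m : ℝ) + 2) * (m + 3))) =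
      2 / (((m : ℝ) + 2) * (m + 3)) := Real.mul_self_sqrt (by positivity)
  rw [PiLp.inner_apply, ← Equiv.sum_comp (finCongr h.symm), Fin.sum_univ_castSucc,
    Fin.sum_univ_add]
  rw [PiLp.inner_apply (𝕜 := ℝ) (veroneseF (m + 1) (dropLast x) (dropLast y)),
    PiLp.inner_apply (𝕜 := ℝ) (x (Fin.last (m + 2)) • dropLast y +
      y (Fin.last (m + 2)) • dropLast x)]
  simp only [veroneseF, finCongr_apply, Fin.cast_cast, Fin.cast_refl, id, Fin.snoc_castSucc,
    Fin.append_left, Fin.append_right, Fin.snoc_last]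
  congr 1
  conv_rhs => rw [← hτ]
  simp only [RCLike.inner_apply, conj_trivial]
  ring

/-- The Gram matrix of the values of `F_m`. The right-hand side is the inner product of the
trace-free parts of the symmetric matrices `(x yᵀ + y xᵀ) / √2` and `(z wᵀ + w zᵀ) / √2`, so `F_m`
is the trace-free symmetric product, written in an orthonormal basis. -/
theorem inner_veroneseF (m : ℕ) (hm : m ≠ 0) (x y z w : EuclideanSpace ℝ (Fin (m + 1))) :
    inner ℝ (veroneseF m x y) (veroneseF m z w) =
      inner ℝ x z * inner ℝ y w + inner ℝ x w * inner ℝ y z -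
        2 / ((m : ℝ) + 1) * (inner ℝ x y * inner ℝ z w) := by
  match m, hm with
  | 1, _ =>
    have h2 : ∀ u v : EuclideanSpace ℝ (Fin 2), inner ℝ u v = u 0 * v 0 + u 1 * v 1 := fun u v => by
      simp [PiLp.inner_apply, Fin.sum_univ_two, mul_comm]
    rw [show inner ℝ (veroneseF 1 x y) (veroneseF 1 z w) = _ from h2 _ _]
    simp only [h2, veroneseF]
    simp
    ring
  | m + 2, _ =>
    rw [inner_veroneseF_add_two, inner_veroneseF (m + 1) (by omega),
      inner_eq_inner_dropLast_add x z, inner_eq_inner_dropLast_add y w,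
      inner_eq_inner_dropLast_add x w, inner_eq_inner_dropLast_add y z,
      inner_eq_inner_dropLast_add x y, inner_eq_inner_dropLast_add z w]
    simp only [inner_add_left, inner_add_right, real_inner_smul_left, real_inner_smul_right]
    push_cast
    field_simp
    ring

/-- `F_m` as a bilinear map. Bilinearity follows from the formula for the inner products: it gives
`0` for the squared norm of each difference that has to vanish. -/
noncomputable def veroneseLin (m : ℕ) [NeZero m] :
    EuclideanSpace ℝ (Fin (m + 1)) →ₗ[ℝ] EuclideanSpace ℝ (Fin (m + 1)) →ₗ[ℝ]
      EuclideanSpace ℝ (Fin (m * (m + 3) / 2)) :=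
  LinearMap.mk₂ ℝ (veroneseF m)
    (fun x x' y => by
      rw [← sub_eq_zero, ← inner_self_eq_zero (𝕜 := ℝ)]
      simp only [inner_sub_left, inner_sub_right, inner_add_left, inner_add_right,
        inner_veroneseF m (NeZero.ne m)]
      ring)
    (fun c x y => by
      rw [← sub_eq_zero, ← inner_self_eq_zero (𝕜 := ℝ)]
      simp only [inner_sub_left, inner_sub_right, real_inner_smul_left, real_inner_smul_right,
        inner_veroneseF m (NeZero.ne m)]
      ring)
    (fun x y y' => by
      rw [← sub_eq_zero, ← inner_self_eq_zero (𝕜 := ℝ)]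
      simp only [inner_sub_left, inner_sub_right, inner_add_left, inner_add_right,
        inner_veroneseF m (NeZero.ne m)]
      ring)
    (fun c x y => by
      rw [← sub_eq_zero, ← inner_self_eq_zero (𝕜 := ℝ)]
      simp only [inner_sub_left, inner_sub_right, real_inner_smul_left, real_inner_smul_right,
        inner_veroneseF m (NeZero.ne m)]
      ring)

theorem veroneseF_symm (m : ℕ) (hm : m ≠ 0) (x y : EuclideanSpace ℝ (Fin (m + 1))) :
    veroneseF m x y = veroneseF m y x := by
  rw [← sub_eq_zero, ← inner_self_eq_zero (𝕜 := ℝ)]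
  simp only [inner_sub_left, inner_sub_right, inner_veroneseF m hm]
  rw [real_inner_comm y x]
  ring

/-- `F_m` as a continuous bilinear map. -/
noncomputable def veroneseCLM (m : ℕ) [NeZero m] :
    EuclideanSpace ℝ (Fin (m + 1)) →L[ℝ] EuclideanSpace ℝ (Fin (m + 1)) →L[ℝ]
      EuclideanSpace ℝ (Fin (m * (m + 3) / 2)) :=
  (veroneseLin m).toContinuousBilinearMap

theorem veroneseCLM_apply (m : ℕ) [NeZero m] (x y : EuclideanSpace ℝ (Fin (m + 1))) :
    veroneseCLM m x y = veroneseF m x y := rfl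

theorem contDiff_veroneseF_self (m : ℕ) [NeZero m] {n : ℕ∞ω} :
    ContDiff ℝ n (fun x => veroneseF m x x) :=
  ((veroneseCLM m).contDiff.clm_apply contDiff_id :)

theorem hasFDerivAt_veroneseF_self (m : ℕ) [NeZero m] (x : EuclideanSpace ℝ (Fin (m + 1))) :
    HasFDerivAt (fun x => veroneseF m x x) ((2 : ℝ) • veroneseCLM m x) x := by
  have h := (veroneseCLM m).hasFDerivAt.clm_apply (hasFDerivAt_id x)
  refine h.congr_fderiv ?_
  ext1 v
  have hs := veroneseF_symm m (NeZero.ne m) v x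
  simp only [← veroneseCLM_apply] at hs
  simp [hs, two_smul]

/-! ### Maps with injective differential are immersions -/

/-- A linear parametrization of a complement of the range of an injective linear map. -/
theorem exists_equiv_prod_of_injective {E F E' : Type*}
    [NormedAddCommGroup E] [NormedSpace ℝ E] [FiniteDimensional ℝ E]
    [NormedAddCommGroup F] [NormedSpace ℝ F] [FiniteDimensional ℝ F]
    [NormedAddCommGroup E'] [NormedSpace ℝ E'] [FiniteDimensional ℝ E']
    (hd : finrank ℝ E + finrank ℝ F = finrank ℝ E') {A : E →L[ℝ] E'} (hA : Injective A) :
    ∃ e : (E × F) ≃L[ℝ] E', ∀ u, e (u, 0) = A u := by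
  obtain ⟨W, hW⟩ := Submodule.exists_isCompl (LinearMap.range A.toLinearMap)
  have h1 := LinearMap.finrank_range_of_inj (f := A.toLinearMap) hA
  have h2 := Submodule.finrank_add_eq_of_isCompl hW
  have j : F ≃ₗ[ℝ] W := LinearEquiv.ofFinrankEq _ _ (by omega)
  let e := ((LinearEquiv.ofInjective A.toLinearMap hA).prodCongr j).trans
    (Submodule.prodEquivOfIsCompl _ _ hW)
  refine ⟨e.toContinuousLinearEquiv, fun u => ?_⟩
  simp [e]

/-- The inverse function theorem, on open sets on which the map and its inverse are analytic. -/
theorem exists_openPartialHomeomorph_contDiffOn {E F : Type*}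
    [NormedAddCommGroup E] [NormedSpace ℝ E] [CompleteSpace E]
    [NormedAddCommGroup F] [NormedSpace ℝ F] {G : E → F} {a : E} {e : E ≃L[ℝ] F}
    (hG : ContDiffAt ℝ ω G a) (he : HasFDerivAt G (e : E →L[ℝ] F) a) :
    ∃ h : OpenPartialHomeomorph E F, a ∈ h.source ∧ (∀ x, h x = G x) ∧
      ContDiffOn ℝ ω h h.source ∧ ContDiffOn ℝ ω h.symm h.target := by
  let h := hG.toOpenPartialHomeomorph G he (by simp)
  have hcoe : ∀ x, h x = G x := fun x => rfl
  have ha : a ∈ h.source := hG.mem_toOpenPartialHomeomorph_source he (by simp)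
  have hinv : ContDiffAt ℝ ω h.symm (G a) := hG.to_localInverse he (by simp)
  have e1 : ∀ᶠ x in 𝓝 a, ContDiffAt ℝ ω h x := hG.eventually (by simp)
  have e2 : ∀ᶠ x in 𝓝 a, ContDiffAt ℝ ω h.symm (h x) :=
    (h.continuousAt ha).tendsto.eventually (hinv.eventually (by simp))
  obtain ⟨U, hU, hUo, haU⟩ := _root_.eventually_nhds_iff.1 (e1.and e2)
  refine ⟨h.restrOpen U hUo, ⟨ha, haU⟩, hcoe, ?_, ?_⟩
  · exact fun x hx => (hU x hx.2).1.contDiffWithinAt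
  · intro y hy
    have hy' : y ∈ h.target ∧ h.symm y ∈ U := by simpa using hy
    have := (hU _ hy'.2).2
    rw [h.right_inv hy'.1] at this
    exact this.contDiffWithinAt

/-- If the differential of an analytic map between finite-dimensional manifolds is injective at a
point, the map is an immersion there, in the sense that it is a linear inclusion in suitable charts.
In charts, `f` becomes a map `g` of vector spaces; adding a linear parametrization of a complement
of the range of its derivative gives a local diffeomorphism `G (u, w) = g u + e (0, w)`, and its
inverse straightens `g`. Analyticity, unlike smoothness of class `∞`, passes from a point to a
neighbourhood; it is what lets the inverse function theorem be applied at a single point. -/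
theorem isImmersionAtOfComplement_of_injective_mfderiv {E F E' M N : Type*}
    [NormedAddCommGroup E] [NormedSpace ℝ E] [FiniteDimensional ℝ E]
    [NormedAddCommGroup F] [NormedSpace ℝ F] [FiniteDimensional ℝ F]
    [NormedAddCommGroup E'] [NormedSpace ℝ E'] [FiniteDimensional ℝ E']
    [TopologicalSpace M] [ChartedSpace E M] [IsManifold 𝓘(ℝ, E) ω M]
    [TopologicalSpace N] [ChartedSpace E' N] [IsManifold 𝓘(ℝ, E') ω N]
    (hd : finrank ℝ E + finrank ℝ F = finrank ℝ E') {f : M → N} {x : M}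
    (hf : ContMDiffAt 𝓘(ℝ, E) 𝓘(ℝ, E') ω f x)
    (hinj : Injective (mfderiv 𝓘(ℝ, E) 𝓘(ℝ, E') f x)) {n : ℕ∞ω} :
    IsImmersionAtOfComplement F 𝓘(ℝ, E) 𝓘(ℝ, E') n f x := by
  have : IsManifold 𝓘(ℝ, E) n M := .of_le (n := ω) le_top
  have : IsManifold 𝓘(ℝ, E') n N := .of_le (n := ω) le_top
  set φ := chartAt E x
  set ψ := chartAt E' (f x)
  set g : E → E' := ψ ∘ f ∘ φ.symm
  set a : E := φ x
  have hg : ContDiffAt ℝ ω g a := by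
    have := (contMDiffAt_iff.1 hf).2
    simpa [g, φ, ψ, a, contDiffWithinAt_univ] using! this
  -- in the charts at `x` and `f x`, the differential is the derivative of `g`
  let A : E →L[ℝ] E' := fderiv ℝ g a
  have hA : Injective A := by
    rw [(hf.mdifferentiableAt (by simp)).mfderiv] at hinj
    simpa [g, φ, ψ, a, A, writtenInExtChartAt, fderivWithin_univ] using! hinj
  obtain ⟨e, he⟩ := exists_equiv_prod_of_injective (F := F) hd hA
  let G : E × F → E' := fun p => g p.1 + e (0, p.2)
  have hG : ContDiffAt ℝ ω G (a, 0) := by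
    have h1 : ContDiffAt ℝ ω (fun p : E × F => g p.1) (a, 0) :=
      ContDiffAt.comp (g := g) (f := Prod.fst) (a, (0 : F)) hg contDiffAt_fst
    exact h1.add (e.contDiff.comp (contDiff_const.prodMk contDiff_snd)).contDiffAt
  have hG' : HasFDerivAt G (e : E × F →L[ℝ] E') (a, 0) := by
    have h0 : HasFDerivAt g A a := (hg.differentiableAt (by simp)).hasFDerivAt
    have h1 : HasFDerivAt (fun p : E × F => g p.1) (A.comp (.fst ℝ E F)) (a, 0) :=
      HasFDerivAt.comp (g := g) (f := Prod.fst) (a, (0 : F)) h0 hasFDerivAt_fst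
    have h2 : HasFDerivAt (fun p : E × F => e (0, p.2))
        ((e : E × F →L[ℝ] E').comp ((ContinuousLinearMap.inr ℝ E F).comp (.snd ℝ E F))) (a, 0) :=
      ((e : E × F →L[ℝ] E').comp
        ((ContinuousLinearMap.inr ℝ E F).comp (.snd ℝ E F))).hasFDerivAt
    refine (h1.add h2).congr_fderiv ?_
    refine ContinuousLinearMap.ext fun p => ?_
    change A p.1 + e (0, p.2) = e p
    rw [← he, ← map_add]
    simp
  obtain ⟨h, ha, hh, hs, ht⟩ := exists_openPartialHomeomorph_contDiffOn hG hG'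
  have hGg : ∀ u, G (u, 0) = g u := fun u => by simp [G]
  have hV : IsOpen {u : E | (u, (0 : F)) ∈ h.source} :=
    h.open_source.preimage (by fun_prop)
  have hψ := contMDiffOn_chart (I := 𝓘(ℝ, E')) (n := n) (x := f x)
  have hψ' := contMDiffOn_chart_symm (I := 𝓘(ℝ, E')) (n := n) (x := f x)
  -- `C` is the chart `ψ` straightened by the inverse `h.symm` of `G`; `D` is the chart `φ`,
  -- restricted to the points `u` at which `h.symm` undoes `G (u, 0) = g u`
  let D := φ.trans (OpenPartialHomeomorph.ofSet _ hV)
  let C := ψ.trans (h.symm.trans e.toHomeomorph.toOpenPartialHomeomorph)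
  refine IsImmersionAtOfComplement.mk_of_continuousAt hf.continuousAt e D C ?_ ?_ ?_ ?_ ?_
  · simpa [D, φ] using! ha
  · have : ψ (f x) ∈ h.target := by
      have h1 := h.map_source ha
      rw [hh, hGg] at h1
      simpa [g, a, φ] using! h1
    simpa [C, ψ] using! this
  · apply OpenPartialHomeomorph.mem_maximalAtlas_of_contMDiffOn
    · exact contMDiffOn_chart.mono (by simp [D, φ])
    · exact contMDiffOn_chart_symm.mono (by simp [D, φ])
  · apply OpenPartialHomeomorph.mem_maximalAtlas_of_contMDiffOn
    · refine (e.contDiff.contMDiff.comp_contMDiffOn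
        ((ht.of_le le_top).contMDiffOn.comp (hψ.mono ?_) ?_))
      · simp [C, ψ]
      · intro y hy
        simpa [C, ψ] using hy.2
    · refine hψ'.comp ((hs.of_le le_top).contMDiffOn.comp
        (e.symm.contDiff.contMDiff.contMDiffOn) ?_) ?_
      · intro y hy
        have : y ∈ C.target := hy
        simp [C] at this
        exact this.1
      · intro y hy
        have : y ∈ C.target := hy
        simp [C] at this
        exact this.2
  · intro u hu
    have hu' : u ∈ φ.target ∧ (u, (0 : F)) ∈ h.source := by
      simpa [D, and_comm] using hu
    change e (h.symm (ψ (f (φ.symm u)))) = e (u, 0)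
    rw [show ψ (f (φ.symm u)) = h (u, 0) by rw [hh, hGg]; rfl, h.left_inv hu'.2]

theorem isImmersion_of_injective_mfderiv {k l : ℕ} {M N : Type*} (hkl : k ≤ l)
    [TopologicalSpace M] [ChartedSpace (EuclideanSpace ℝ (Fin k)) M] [IsManifold (𝓡 k) ω M]
    [TopologicalSpace N] [ChartedSpace (EuclideanSpace ℝ (Fin l)) N] [IsManifold (𝓡 l) ω N]
    {f : M → N} (hf : ContMDiff (𝓡 k) (𝓡 l) ω f)
    (hinj : ∀ x, Injective (mfderiv (𝓡 k) (𝓡 l) f x)) {n : ℕ∞ω} :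
    IsImmersion (𝓡 k) (𝓡 l) n f :=
  ⟨EuclideanSpace ℝ (Fin (l - k)), inferInstance, inferInstance, fun x =>
    isImmersionAtOfComplement_of_injective_mfderiv (by simp; omega) (hf x) (hinj x)⟩

/-! ### Geometry of the sphere and the projective space -/

/-- Tangent vectors of the sphere are orthogonal to the position vector. -/
theorem RSphere.inner_val_mvfderiv_val {V : Type*} [NormedAddCommGroup V] [InnerProductSpace ℝ V]
    {n : ℕ} [Fact (finrank ℝ V = n + 1)] {r : ℝ} [Fact (0 < r)] (x : RSphere V r)
    (v : TangentSpace (𝓡 n) x) : inner ℝ x.val (mvfderiv (𝓡 n) RSphere.val x v) = 0 := by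
  have h1 : MDifferentiableAt (𝓡 n) 𝓘(ℝ, V) (RSphere.val : RSphere V r → V) x :=
    RSphere.contMDiff_val.mdifferentiableAt (by simp)
  have h2 : HasFDerivAt (fun y : V => ‖y‖ ^ 2) (2 • innerSL ℝ x.val) x.val :=
    (hasStrictFDerivAt_norm_sq x.val).hasFDerivAt
  have h3 := HasMFDerivAt.comp x h2.hasMFDerivAt h1.hasMFDerivAt
  have e : (fun y : V => ‖y‖ ^ 2) ∘ (RSphere.val : RSphere V r → V) = fun _ => r ^ 2 :=
    funext fun y => by simp [y.norm_val]
  rw [e] at h3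
  have h4 := hasMFDerivAt_unique h3 (hasMFDerivAt_const (r ^ 2) x)
  have h5 := congrArg (fun L : TangentSpace (𝓡 n) x →L[ℝ] ℝ => L v) h4
  have h6 : (2 • innerSL ℝ x.val) (mvfderiv (𝓡 n) RSphere.val x v) = 0 := h5
  simpa using h6

namespace RP

variable {m : ℕ} {r : ℝ}

instance compactSpace : CompactSpace (RP m r) := by
  have : CompactSpace (RSphere (EuclideanSpace ℝ (Fin (m + 1))) r) :=
    isCompact_iff_compactSpace.1 (isCompact_sphere _ _)
  exact inferInstanceAs (CompactSpace (Quotient (antipodalSetoid m r)))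

theorem surjective_mk : Surjective (mk : _ → RP m r) := fun p => ⟨p.out, mk_out p⟩

end RP

/-! ### The Veronese embedding -/

theorem radius_sq (m : ℕ) [NeZero m] : radius m ^ 2 = 2 * ((m : ℝ) + 1) / m :=
  Real.sq_sqrt (by positivity)

theorem PhiTilde_eq (m : ℕ) (x : EuclideanSpace ℝ (Fin (m + 1))) :
    PhiTilde m x = (1 / (2 * radius m)) • veroneseF m x x := by
  have h : √((m : ℝ) / (2 * ((m : ℝ) + 1))) = (radius m)⁻¹ := by
    rw [radius, ← Real.sqrt_inv, inv_div]
  rw [PhiTilde, h, one_div, one_div, mul_inv]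

theorem PhiR_mk (m : ℕ) [NeZero m] (r : ℝ) (x : RSphere (EuclideanSpace ℝ (Fin (m + 1))) r) :
    PhiR m r (RP.mk x) = (1 / (2 * r)) • veroneseF m x.val x.val := by
  have h : radius m ≠ 0 := (fact_radius_pos m).out.ne'
  change (radius m / r) • PhiTilde m x.val = _
  rw [PhiTilde_eq, smul_smul]
  congr 1
  field_simp

theorem PhiR_rescale (m : ℕ) [NeZero m] (r : ℝ) [hr : Fact (0 < r)] (p : RP m (radius m)) :
    PhiR m r (RP.rescale (radius m) r p) = (r / radius m) • Phi m p := by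
  obtain ⟨x, rfl⟩ := RP.surjective_mk p
  have hr0 : r ≠ 0 := hr.out.ne'
  have h : radius m ≠ 0 := (fact_radius_pos m).out.ne'
  change PhiR m r (RP.mk (RSphere.mk ((r / radius m) • x.val) _)) = _ • PhiTilde m x.val
  rw [PhiR_mk, PhiTilde_eq, RSphere.val_mk]
  simp only [← veroneseCLM_apply, map_smul, smul_apply, smul_smul]
  congr 1
  field_simp

theorem norm_PhiR (m : ℕ) [NeZero m] (r : ℝ) [hr : Fact (0 < r)] (p : RP m r) :
    ‖PhiR m r p‖ = r / radius m := by
  obtain ⟨x, rfl⟩ := RP.surjective_mk p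
  have hr0 : 0 < r := hr.out
  have h : 0 < radius m := (fact_radius_pos m).out
  have hm : (m : ℝ) ≠ 0 := Nat.cast_ne_zero.2 (NeZero.ne m)
  rw [← sq_eq_sq₀ (norm_nonneg _) (by positivity), ← real_inner_self_eq_norm_sq, PhiR_mk,
    real_inner_smul_left, real_inner_smul_right, inner_veroneseF m (NeZero.ne m),
    real_inner_self_eq_norm_sq, x.norm_val, div_pow, radius_sq]
  field_simp
  ring

/-- By the equality case of the Cauchy-Schwarz inequality, `F_m(x, x)` determines a vector of
given length up to sign. -/
theorem injective_PhiR (m : ℕ) [NeZero m] (r : ℝ) [hr : Fact (0 < r)] :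
    Injective (PhiR m r) := by
  intro p q hpq
  obtain ⟨x, rfl⟩ := RP.surjective_mk p
  obtain ⟨y, rfl⟩ := RP.surjective_mk q
  have hr0 : 0 < r := hr.out
  rw [PhiR_mk, PhiR_mk] at hpq
  have h1 : veroneseF m x.val x.val = veroneseF m y.val y.val :=
    smul_right_injective _ (by positivity : 1 / (2 * r) ≠ 0) hpq
  have h2 := congrArg (inner ℝ (veroneseF m x.val x.val)) h1
  simp only [inner_veroneseF m (NeZero.ne m), real_inner_self_eq_norm_sq, RSphere.norm_val] at h2
  have h3 : (inner ℝ x.val y.val - r ^ 2) * (inner ℝ x.val y.val + r ^ 2) = 0 := by linarith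
  rw [RP.mk_eq_mk]
  rcases mul_eq_zero.1 h3 with h | h
  · left
    apply RSphere.val_injective
    rw [← sub_eq_zero, ← norm_eq_zero, ← sq_eq_zero_iff, norm_sub_sq_real, x.norm_val, y.norm_val]
    linarith
  · right
    apply RSphere.val_injective
    rw [RSphere.val_neg, eq_neg_iff_add_eq_zero, ← norm_eq_zero, ← sq_eq_zero_iff,
      norm_add_sq_real, x.norm_val, y.norm_val]
    linarith

/-- Locally, `Φ_r` is a quadratic map composed with a local inverse of the quotient map. -/
theorem contMDiff_PhiR (m : ℕ) [NeZero m] (r : ℝ) [hr : Fact (0 < r)] :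
    ContMDiff (𝓡 m) 𝓘(ℝ, EuclideanSpace ℝ (Fin (m * (m + 3) / 2))) ω (PhiR m r) := by
  intro p
  obtain ⟨x, rfl⟩ := RP.surjective_mk p
  have hx := RP.isLocalDiffeomorph_mk x
  have h1 : ContMDiff (𝓡 m) 𝓘(ℝ, EuclideanSpace ℝ (Fin (m * (m + 3) / 2))) ω
      (fun y : RSphere (EuclideanSpace ℝ (Fin (m + 1))) r =>
        (1 / (2 * r)) • veroneseF m y.val y.val) :=
    ((contDiff_veroneseF_self m).const_smul (1 / (2 * r))).contMDiff.comp RSphere.contMDiff_val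
  refine ((h1 _).comp (RP.mk x) hx.localInverse_contMDiffAt).congr_of_eventuallyEq ?_
  filter_upwards [hx.localInverse_eventuallyEq_right] with q hq
  rw [comp_apply, ← PhiR_mk]
  exact congrArg _ hq.symm

/-- The differential of `x ↦ Φ_r([x])` at a point `x` of the sphere is `v ↦ F_m(x, v) / r`. -/
theorem mvfderiv_PhiR_mk (m : ℕ) [NeZero m] (r : ℝ) [hr : Fact (0 < r)]
    (x : RSphere (EuclideanSpace ℝ (Fin (m + 1))) r) (v : TangentSpace (𝓡 m) x) :
    mvfderiv (𝓡 m) (PhiR m r) (RP.mk x) (mfderiv (𝓡 m) (𝓡 m) RP.mk x v) =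
      (1 / r) • veroneseF m x.val (mvfderiv (𝓡 m) RSphere.val x v) := by
  have h1 : MDifferentiableAt (𝓡 m) 𝓘(ℝ, EuclideanSpace ℝ (Fin (m + 1)))
      (RSphere.val : RSphere (EuclideanSpace ℝ (Fin (m + 1))) r → _) x :=
    RSphere.contMDiff_val.mdifferentiableAt (by simp)
  have h2 := HasMFDerivAt.comp x
    (((hasFDerivAt_veroneseF_self m x.val).const_smul (1 / (2 * r))).hasMFDerivAt)
    h1.hasMFDerivAt
  have h3 := HasMFDerivAt.comp x
    ((contMDiff_PhiR m r).mdifferentiableAt (x := RP.mk x) (by simp)).hasMFDerivAt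
    ((RP.isLocalDiffeomorph_mk (r := r) x).mdifferentiableAt (by simp)).hasMFDerivAt
  have e : PhiR m r ∘ RP.mk = _ := funext (PhiR_mk m r)
  rw [e] at h3
  have h4 := hasMFDerivAt_unique h3 h2
  have h5 := congrArg (fun L : TangentSpace (𝓡 m) x →L[ℝ]
    EuclideanSpace ℝ (Fin (m * (m + 3) / 2)) => L v) h4
  refine (show _ = (1 / (2 * r)) • (2 : ℝ) • veroneseF m x.val (mvfderiv (𝓡 m) RSphere.val x v)
    from h5).trans ?_
  rw [smul_smul]
  congr 1
  have := hr.out.ne'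
  field_simp

/-- `Φ_r` preserves the metrics: if `v` and `w` are orthogonal to `x` and `‖x‖ = r`, the inner
product of `F_m(x, v)` and `F_m(x, w)` is `r²` times that of `v` and `w`. -/
theorem inner_mvfderiv_PhiR (m : ℕ) [NeZero m] (r : ℝ) [hr : Fact (0 < r)] (p : RP m r)
    (v w : TangentSpace (𝓡 m) p) :
    inner ℝ (mvfderiv (𝓡 m) (PhiR m r) p v) (mvfderiv (𝓡 m) (PhiR m r) p w) =
      RP.metric.inner p v w := by
  obtain ⟨x, rfl⟩ := RP.surjective_mk p
  let D := (RP.isLocalDiffeomorph_mk (r := r) x).mfderivToContinuousLinearEquiv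
    (show (ω : ℕ∞ω) ≠ 0 by simp)
  obtain ⟨v, rfl⟩ := D.surjective v
  obtain ⟨w, rfl⟩ := D.surjective w
  have hr0 := hr.out.ne'
  refine Eq.trans ?_ (RP.metric_mk x v w).symm
  change inner ℝ (mvfderiv (𝓡 m) (PhiR m r) (RP.mk x) (mfderiv (𝓡 m) (𝓡 m) RP.mk x v))
    (mvfderiv (𝓡 m) (PhiR m r) (RP.mk x) (mfderiv (𝓡 m) (𝓡 m) RP.mk x w)) =
    inner ℝ (mvfderiv (𝓡 m) RSphere.val x v) (mvfderiv (𝓡 m) RSphere.val x w)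
  rw [mvfderiv_PhiR_mk, mvfderiv_PhiR_mk, real_inner_smul_left, real_inner_smul_right,
    inner_veroneseF m (NeZero.ne m), real_inner_self_eq_norm_sq, x.norm_val,
    RSphere.inner_val_mvfderiv_val, RSphere.inner_val_mvfderiv_val]
  field_simp
  ring

theorem mainTheorem8 (m : ℕ) (hm : 2 ≤ m) (r : ℝ) (hr : 0 < r) :
    haveI : NeZero m := ⟨by omega⟩
    haveI : Fact (0 < r) := ⟨hr⟩
    (∀ p : RP m (radius m), PhiR m r (RP.rescale (radius m) r p) = (r / radius m) • Phi m p) ∧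
    ∃ h : ∀ p : RP m r, ‖PhiR m r p‖ = r / radius m,
      IsIsometricEmbedding (M := RP m r)
        (N := RSphere (EuclideanSpace ℝ (Fin (m * (m + 3) / 2))) (r / radius m))
        (l := m * (m + 3) / 2 - 1)
        RP.metric RSphere.metric (fun p => RSphere.mk (PhiR m r p) (h p)) := by
  have : NeZero m := ⟨by omega⟩
  have : Fact (0 < r) := ⟨hr⟩
  refine ⟨PhiR_rescale m r, norm_PhiR m r, ?_⟩
  set f : RP m r → RSphere (EuclideanSpace ℝ (Fin (m * (m + 3) / 2))) (r / radius m) :=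
    fun p => RSphere.mk (PhiR m r p) (norm_PhiR m r p)
  have hf : ContMDiff (𝓡 m) (𝓡 (m * (m + 3) / 2 - 1)) ω f :=
    RSphere.contMDiff_codRestrict (contMDiff_PhiR m r)
  have hmetric : ∀ (p : RP m r) (v w : TangentSpace (𝓡 m) p),
      RSphere.metric.inner (f p) (mfderiv (𝓡 m) (𝓡 (m * (m + 3) / 2 - 1)) f p v)
        (mfderiv (𝓡 m) (𝓡 (m * (m + 3) / 2 - 1)) f p w) = RP.metric.inner p v w := by
    intro p v w
    have hval : MDifferentiableAt (𝓡 (m * (m + 3) / 2 - 1)) 𝓘(ℝ, _) RSphere.val (f p) :=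
      RSphere.contMDiff_val.mdifferentiableAt (by simp)
    have hcomp := mfderiv_comp p hval (hf.mdifferentiableAt (by simp))
    have hv : ∀ u : TangentSpace (𝓡 m) p,
        mvfderiv (𝓡 (m * (m + 3) / 2 - 1)) RSphere.val (f p)
          (mfderiv (𝓡 m) (𝓡 (m * (m + 3) / 2 - 1)) f p u) = mvfderiv (𝓡 m) (PhiR m r) p u :=
      fun u => (congrArg (fun L : TangentSpace (𝓡 m) p →L[ℝ]
        EuclideanSpace ℝ (Fin (m * (m + 3) / 2)) => L u) hcomp).symm
    rw [← inner_mvfderiv_PhiR, ← hv, ← hv]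
    rfl
  -- a map that preserves the metrics has injective differentials
  have hinj : ∀ p, Injective (mfderiv (𝓡 m) (𝓡 (m * (m + 3) / 2 - 1)) f p) := by
    intro p
    rw [injective_iff_map_eq_zero]
    intro v hv
    by_contra hne
    have := RP.metric.pos p v hne
    rw [← hmetric, hv] at this
    simp at this
  have hdim : m ≤ m * (m + 3) / 2 - 1 := by
    have h1 : (m + 1) * 2 ≤ m * (m + 3) := by nlinarith
    omega
  -- the projective space is compact, so a continuous injection into the sphere is an embedding
  refine ⟨⟨isImmersion_of_injective_mfderiv hdim hf hinj, ?_⟩, hmetric⟩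
  exact (hf.continuous.isClosedEmbedding fun p q hpq =>
    injective_PhiR m r (congrArg RSphere.val hpq)).isEmbedding
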